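/- View a permutation $\sigma\in S_n$ as a row of $n$ cards numbered $1,\dots,n$, where $\sigma_i$ is the number of the card in the $i$-th position from the left, so that $\sigma^{-1}_k$ is the position of card $k$. The card-cyclic to random insertion shuffle removes each of the $n$ cards exactly once, in their original left to right order, and immediately reinserts each one in a position of the row chosen uniformly from $\{1,\dots,n\}$, independently of all other choices. Let $p_n(\mathrm{id},\cdot)$ be the law on $S_n$ of the final row when the initial row is $1,2,\dots,n$. For $b\in[0,1]$ let $G_b:[0,1]\to[0,1]$ be the increasing bijection $$G_b(y)=\begin{cases} y\,e^{1-b}, & 0\le y\le 1-(1-b)e^b,\\ e^{(1-y)e^{-b}}-(1-y)e^{1-b}, & 1-(1-b)e^b\le y\le 1,\end{cases}$$ let $F_b=G_b^{-1}$, and let $f_b=F_b'$ on $[0,1]$ (defined almost everywhere), $f_b=0$ elsewhere. Let $m\ge 1$ and, for all sufficiently large $n$, let $1\le k_{1,n}<k_{2,n}<\cdots<k_{m,n}\le n$ be integers such that $\lim_{n\to\infty}k_{j,n}/n=b_j\in[0,1]$ for $j=1,\dots,m$ (so $0\le b_1\le\cdots\le b_m\le 1$). Then, as $n\to\infty$,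 the distribution under $p_n(\mathrm{id},\cdot)$ of the random vector $$\tfrac1n\bigl(\sigma^{-1}_{k_{1,n}},\sigma^{-1}_{k_{2,n}},\dots,\sigma^{-1}_{k_{m,n}}\bigr)$$ converges weakly to the product probability measure on $\mathbb R^m$ whose factors have densities $f_{b_1},\dots,f_{b_m}$, that is, to the probability measure with density $\prod_{j=1}^m f_{b_j}(x_j)$. -/

import Mathlib

open Filter Topology MeasureTheory

namespace CardCyclic

/-- Remove card `c` from the row `σ` and reinsert it in position `r`, keeping the order of the other
cards. A row of `n + 1` cards is a permutation `σ`, where `σ i` is the card in the `i`-th position from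
the left. With `i = σ⁻¹ c` the current position of `c`, the new row has `c` in position `r`, and its
remaining positions, read from left to right, carry the remaining cards of `σ`, read from left to
right: `r ↦ σ i = c` and `r.succAbove x ↦ σ (i.succAbove x)`. -/
def reinsert {n : ℕ} (σ : Equiv.Perm (Fin (n + 1))) (c r : Fin (n + 1)) :
    Equiv.Perm (Fin (n + 1)) :=
  ((finSuccEquiv' r).trans (finSuccEquiv' (σ⁻¹ c)).symm).trans σ

/-- The row obtained from `σ` by removing and reinserting every card exactly once, the cards being
taken in their original left to right order `σ 0, σ 1, …, σ n`; the card `σ i` is reinserted in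
position `r i`. -/
def shuffle {n : ℕ} (σ : Equiv.Perm (Fin (n + 1))) (r : Fin (n + 1) → Fin (n + 1)) :
    Equiv.Perm (Fin (n + 1)) :=
  (List.finRange (n + 1)).foldl (fun τ i => reinsert τ (σ i) (r i)) σ

/-- One card-cyclic to random insertion shuffle of `n + 1` cards started from `σ`: the law of the
final row when the `n + 1` reinsertion positions are independent and uniform. -/
noncomputable def shuffleLaw {n : ℕ} (σ : Equiv.Perm (Fin (n + 1))) :
    PMF (Equiv.Perm (Fin (n + 1))) :=
  (PMF.uniformOfFintype (Fin (n + 1) → Fin (n + 1))).map (shuffle σ)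

/-- The rescaled one-based index `(c + 1) / (n + 1)` of a card or position `c` among `n + 1`. -/
noncomputable def rescale {n : ℕ} (c : Fin (n + 1)) : ℝ := ((c : ℕ) + 1 : ℝ) / ((n : ℝ) + 1)

/-- The joint law of the rescaled final positions of the cards `c 0, c 1, …` when the deck
starts in increasing order. -/
noncomputable def positionLaw {m n : ℕ} (c : Fin m → Fin (n + 1)) :
    ProbabilityMeasure (Fin m → ℝ) :=
  ⟨((shuffleLaw (1 : Equiv.Perm (Fin (n + 1)))).map
      (fun σ j => rescale (σ⁻¹ (c j)))).toMeasure, inferInstance⟩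

/-- The increasing bijection `G_b` of `[0, 1]`. -/
noncomputable def quantile (b y : ℝ) : ℝ :=
  if y ≤ 1 - (1 - b) * Real.exp b then y * Real.exp (1 - b)
  else Real.exp ((1 - y) * Real.exp (-b)) - (1 - y) * Real.exp (1 - b)

/-- The distribution function `F_b = G_b⁻¹` on `[0, 1]`. -/
noncomputable def distFun (b : ℝ) : ℝ → ℝ :=
  Function.invFunOn (quantile b) (Set.Icc 0 1)

/-- The density `f_b = F_b'` on `[0, 1]`, extended by zero. -/
noncomputable def density (b : ℝ) : ℝ → ℝ :=
  (Set.Icc (0 : ℝ) 1).indicator (derivWithin (distFun b) (Set.Icc 0 1))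

end CardCyclic

namespace CardCyclic

open scoped BigOperators

variable {n : ℕ}

/-! Write N = n + 1 and g = 1 + 1/N, with zero-based positions. Up to a mean error of order √N, the
final position of card k depends only on the position `r k` where it is inserted. Since the `r k`
are independent and uniform, the limit law is a product.

While a card is not itself being moved, each step displaces it by a fresh Bernoulli variable, so it
follows the recursion `drift` with accumulated variance O(N) (`expect_sq_pos_sub_drift`). A card t >
k sees only removals on its left before time k, so at time k it stands near N - (N - t) g ^ k. That
position is independent of `r k`; hence `r k` predicts, outside probability O(1/√N), whether t will
be removed from the left of k (`expect_abs_leftOf_sub_le`). The predicted sides, fed into `drift`,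
give the deterministic `target` (`expect_abs_pos_sub_target_le`).

If k/N → b and ρ/N → u, then `target`/N → G_b(u) (`tendsto_target`). In the first branch of G_b
asymptotically no unmoved card lies to the left of the inserted one; in the second a positive
proportion does. Finally G_b(U), with U uniform, has density f_b (`map_quantile`). -/

/-! ### Effect of a single reinsertion on positions. -/

lemma reinsert_inv_self (σ : Equiv.Perm (Fin (n + 1))) (c r : Fin (n + 1)) :
    (reinsert σ c r)⁻¹ c = r := by
  rw [Equiv.Perm.inv_eq_iff_eq]
  simp [reinsert]

lemma reinsert_inv_succAbove (σ : Equiv.Perm (Fin (n + 1))) (c r d : Fin (n + 1)) (x : Fin n)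
    (hx : (σ⁻¹ c).succAbove x = σ⁻¹ d) :
    (reinsert σ c r)⁻¹ d = r.succAbove x := by
  rw [Equiv.Perm.inv_eq_iff_eq]
  simp only [reinsert, Equiv.trans_apply, finSuccEquiv'_succAbove, finSuccEquiv'_symm_some, hx]
  simp

/-- The new position of a card to the right of the one being moved. -/
lemma reinsert_inv_of_lt {σ : Equiv.Perm (Fin (n + 1))} {c d : Fin (n + 1)} (r : Fin (n + 1))
    (h : σ⁻¹ c < σ⁻¹ d) :
    (((reinsert σ c r)⁻¹ d : Fin (n + 1)) : ℕ) =
      if r < σ⁻¹ d then ((σ⁻¹ d : Fin (n + 1)) : ℕ) else (σ⁻¹ d : Fin (n + 1)) - 1 := by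
  obtain ⟨x, hx⟩ := Fin.exists_succAbove_eq h.ne'
  rw [reinsert_inv_succAbove σ c r d x hx]
  rw [← hx] at h ⊢
  generalize σ⁻¹ c = i at *
  simp only [Fin.succAbove, Fin.lt_def] at h ⊢
  split_ifs at h ⊢ <;> simp_all <;> omega

/-- The new position of a card to the left of the one being moved. -/
lemma reinsert_inv_of_gt {σ : Equiv.Perm (Fin (n + 1))} {c d : Fin (n + 1)} (r : Fin (n + 1))
    (h : σ⁻¹ d < σ⁻¹ c) :
    (((reinsert σ c r)⁻¹ d : Fin (n + 1)) : ℕ) =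
      if r ≤ σ⁻¹ d then ((σ⁻¹ d : Fin (n + 1)) : ℕ) + 1 else (σ⁻¹ d : Fin (n + 1)) := by
  obtain ⟨x, hx⟩ := Fin.exists_succAbove_eq h.ne
  rw [reinsert_inv_succAbove σ c r d x hx]
  rw [← hx] at h ⊢
  generalize σ⁻¹ c = i at *
  simp only [Fin.succAbove, Fin.lt_def, Fin.le_def] at h ⊢
  split_ifs at h ⊢ <;> simp_all <;> omega

/-- Moving a card does not change the order of the others. -/
lemma reinsert_inv_lt_iff (σ : Equiv.Perm (Fin (n + 1))) {c d e : Fin (n + 1)} (r : Fin (n + 1))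
    (hd : d ≠ c) (he : e ≠ c) :
    (reinsert σ c r)⁻¹ d < (reinsert σ c r)⁻¹ e ↔ σ⁻¹ d < σ⁻¹ e := by
  obtain ⟨x, hx⟩ := Fin.exists_succAbove_eq (σ⁻¹.injective.ne hd)
  obtain ⟨y, hy⟩ := Fin.exists_succAbove_eq (σ⁻¹.injective.ne he)
  rw [reinsert_inv_succAbove σ c r d x hx, reinsert_inv_succAbove σ c r e y hy, ← hx, ← hy,
    Fin.succAbove_lt_succAbove_iff, Fin.succAbove_lt_succAbove_iff]

/-! ### Trajectories of cards during the shuffle. -/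

/-- The row after the first `t` insertions, starting from the increasing one. -/
def stage (r : Fin (n + 1) → Fin (n + 1)) : ℕ → Equiv.Perm (Fin (n + 1))
  | 0 => 1
  -- `Fin.ofNat` wraps around for t > n; the shuffle only uses t ≤ n.
  | t + 1 => reinsert (stage r t) (Fin.ofNat (n + 1) t) (r (Fin.ofNat (n + 1) t))

/-- The position of card `d` after the first `t` insertions. -/
def pos (r : Fin (n + 1) → Fin (n + 1)) (t : ℕ) (d : Fin (n + 1)) : Fin (n + 1) :=
  (stage r t)⁻¹ d

lemma stage_succ (r : Fin (n + 1) → Fin (n + 1)) (i : Fin (n + 1)) :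
    stage r ((i : ℕ) + 1) = reinsert (stage r i) i (r i) := by
  simp [stage]

lemma shuffle_one (r : Fin (n + 1) → Fin (n + 1)) : shuffle 1 r = stage r (n + 1) := by
  have key : ∀ t ≤ n + 1, ((List.finRange (n + 1)).take t).foldl
      (fun τ i => reinsert τ ((1 : Equiv.Perm (Fin (n + 1))) i) (r i)) 1 = stage r t := by
    intro t
    induction t with
    | zero => intro _; simp [stage]
    | succ t ih =>
      intro ht
      have hlt : t < (List.finRange (n + 1)).length := by simpa using ht
      rw [← List.take_concat_get' _ t hlt, List.foldl_append, ih (by omega)]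
      have := stage_succ r ⟨t, ht⟩
      simp only at this
      rw [this]
      simp
  have h := key (n + 1) le_rfl
  rwa [List.take_of_length_le (by simp)] at h

lemma pos_zero (r : Fin (n + 1) → Fin (n + 1)) (d : Fin (n + 1)) : pos r 0 d = d := by
  simp [pos, stage]

lemma pos_succ_self (r : Fin (n + 1) → Fin (n + 1)) (i : Fin (n + 1)) :
    pos r ((i : ℕ) + 1) i = r i := by
  rw [pos, stage_succ, reinsert_inv_self]

lemma pos_succ_lt_iff (r : Fin (n + 1) → Fin (n + 1)) {i d e : Fin (n + 1)}
    (hd : d ≠ i) (he : e ≠ i) :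
    pos r ((i : ℕ) + 1) d < pos r ((i : ℕ) + 1) e ↔ pos r i d < pos r i e := by
  simp only [pos, stage_succ]
  exact reinsert_inv_lt_iff _ _ hd he

lemma pos_succ_of_lt (r : Fin (n + 1) → Fin (n + 1)) {i d : Fin (n + 1)}
    (h : pos r i i < pos r i d) :
    (pos r ((i : ℕ) + 1) d : ℕ) =
      if r i < pos r i d then (pos r i d : ℕ) else (pos r i d : ℕ) - 1 := by
  simp only [pos, stage_succ] at h ⊢
  exact reinsert_inv_of_lt _ h

lemma pos_succ_of_gt (r : Fin (n + 1) → Fin (n + 1)) {i d : Fin (n + 1)}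
    (h : pos r i d < pos r i i) :
    (pos r ((i : ℕ) + 1) d : ℕ) =
      if r i ≤ pos r i d then (pos r i d : ℕ) + 1 else (pos r i d : ℕ) := by
  simp only [pos, stage_succ] at h ⊢
  exact reinsert_inv_of_gt _ h

/-- Cards that have not been moved yet are in increasing order. -/
lemma pos_lt_pos (r : Fin (n + 1) → Fin (n + 1)) {t : ℕ} {d e : Fin (n + 1)} (ht : t ≤ d)
    (hde : d < e) : pos r t d < pos r t e := by
  induction t with
  | zero => simpa [pos_zero] using hde
  | succ t ih =>
    have hd : t < n + 1 := by omega
    have := pos_succ_lt_iff r (i := ⟨t, hd⟩) (d := d) (e := e)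
      (by rintro rfl; simp at ht) (by rintro rfl; rw [Fin.lt_def] at hde; simp at hde; omega)
    exact this.2 (ih (by omega))

/-- The relative order of two cards is kept while neither is moved. -/
lemma pos_lt_pos_iff (r : Fin (n + 1) → Fin (n + 1)) {s t : ℕ} {d e : Fin (n + 1)} (hst : s ≤ t)
    (hd : (d : ℕ) < s ∨ t ≤ d) (he : (e : ℕ) < s ∨ t ≤ e) (ht : t ≤ n + 1) :
    pos r t d < pos r t e ↔ pos r s d < pos r s e := by
  induction t, hst using Nat.le_induction with
  | base => rfl
  | succ t hst ih =>
    have := pos_succ_lt_iff r (i := ⟨t, ht⟩) (d := d) (e := e)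
      (by rintro rfl; simp at hd; omega) (by rintro rfl; simp at he; omega)
    rw [← ih (by omega) (by omega) (by omega)]
    exact this

/-- When the unmoved card `t` is reached, it lies to the left of the previously moved card `k` iff
it had not lain to the right of the position in which `k` was inserted. -/
lemma pos_lt_pos_iff_le (r : Fin (n + 1) → Fin (n + 1)) {k t : Fin (n + 1)} (hkt : k < t) :
    pos r t t < pos r t k ↔ pos r k t ≤ r k := by
  have hkt' := Fin.lt_def.1 hkt
  -- The order of k and t is frozen while the cards strictly between them are moved, so it can be
  -- read off just after k is inserted.
  rw [pos_lt_pos_iff r (s := (k : ℕ) + 1) (by omega) (by omega) (by omega) (by omega),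
    pos_succ_self]
  have h := pos_lt_pos r le_rfl hkt
  have h2 := pos_succ_of_lt r h
  rw [Fin.lt_def, h2, Fin.le_def]
  rw [Fin.lt_def] at h
  split_ifs with h3 <;> rw [Fin.lt_def] at h3 <;> omega

/-- The first t steps use only the insertions of cards below t. This is the independence of the past
from `r i` for i ≥ t. -/
lemma stage_update (r : Fin (n + 1) → Fin (n + 1)) (i ρ : Fin (n + 1)) {t : ℕ} (ht : t ≤ i) :
    stage (Function.update r i ρ) t = stage r t := by
  induction t with
  | zero => rfl
  | succ t ih =>
    have hne : Fin.ofNat (n + 1) t ≠ i := by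
      rintro rfl
      rw [Fin.val_ofNat] at ht
      have := Nat.mod_le t (n + 1)
      omega
    rw [stage, stage, ih (by omega), Function.update_of_ne hne]

lemma pos_update (r : Fin (n + 1) → Fin (n + 1)) (i ρ d : Fin (n + 1)) {t : ℕ} (ht : t ≤ i) :
    pos (Function.update r i ρ) t d = pos r t d := by
  rw [pos, stage_update r i ρ ht, pos]

/-! ### Averages over uniform insertion positions. -/

/-- Averaging over all functions may be preceded by averaging over the value at one point. -/
lemma expect_update {ι α : Type*} [Fintype ι] [DecidableEq ι] [Fintype α]
    (φ : (ι → α) → ℝ) (i : ι) :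
    𝔼 r, 𝔼 ρ, φ (Function.update r i ρ) = 𝔼 r, φ r := by
  rcases isEmpty_or_nonempty α with hα | hα
  · have : IsEmpty (ι → α) := ⟨fun r => hα.false (r i)⟩
    simp
  -- Exchanging the stored value at i with the fresh value ρ is a bijection of the pairs (r, ρ).
  have hinv : Function.Involutive
      (fun p : (ι → α) × α => (Function.update p.1 i p.2, p.1 i)) := by
    rintro ⟨r, ρ⟩
    simp
  calc 𝔼 r, 𝔼 ρ, φ (Function.update r i ρ)
      = 𝔼 p : (ι → α) × α, φ (Function.update p.1 i p.2) := by
        rw [← Finset.univ_product_univ, Finset.expect_product]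
    _ = 𝔼 p : (ι → α) × α, φ p.1 :=
        Fintype.expect_equiv hinv.toPerm _ _ fun p => rfl
    _ = 𝔼 r, φ r := by
        rw [← Finset.univ_product_univ, Finset.expect_product]
        simp

lemma expect_ite_val_lt {N L : ℕ} (hL : L ≤ N) :
    𝔼 ρ : Fin N, (if (ρ : ℕ) < L then (1 : ℝ) else 0) = L / N := by
  rw [Fintype.expect_eq_sum_div_card, Finset.sum_boole, Fin.card_filter_val_lt, Fintype.card_fin,
    min_eq_right hL]

/-- Mean square = squared mean + variance; the indicator has mean L/N and variance at most 1. -/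
lemma expect_sq_add_ite {N L : ℕ} (hN : 0 < N) (hL : L ≤ N) (y : ℝ) :
    𝔼 ρ : Fin N, (y + (if (ρ : ℕ) < L then (1 : ℝ) else 0)) ^ 2 ≤ (y + L / N) ^ 2 + 1 := by
  have : Nonempty (Fin N) := ⟨⟨0, hN⟩⟩
  have h : ∀ ρ : Fin N, (y + (if (ρ : ℕ) < L then (1 : ℝ) else 0)) ^ 2 =
      y ^ 2 + (2 * y + 1) * (if (ρ : ℕ) < L then (1 : ℝ) else 0) := by
    intro ρ
    split_ifs <;> ring
  simp_rw [h]
  rw [Finset.expect_add_distrib, ← Finset.mul_expect, expect_ite_val_lt hL, Fintype.expect_const]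
  have h1 : (L : ℝ) / N ≤ 1 := div_le_one_of_le₀ (by exact_mod_cast hL) (by positivity)
  nlinarith [sq_nonneg ((L : ℝ) / N)]

/-- The two indicators differ only at the integers between the thresholds, of which there are at
most |x - y| + 1. -/
lemma expect_abs_ite_sub_ite_le {N : ℕ} (x y : ℝ) :
    𝔼 ρ : Fin N, |(if x ≤ (ρ : ℕ) then (1 : ℝ) else 0) - (if y ≤ (ρ : ℕ) then 1 else 0)| ≤
      (|x - y| + 1) / N := by
  wlog hxy : x ≤ y generalizing x y
  · have := this y x (le_of_not_ge hxy)
    rw [abs_sub_comm y x] at this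
    simpa only [abs_sub_comm] using this
  rw [Fintype.expect_eq_sum_div_card, Fintype.card_fin]
  gcongr
  have h : ∀ ρ : Fin N, |(if x ≤ (ρ : ℕ) then (1 : ℝ) else 0) - (if y ≤ (ρ : ℕ) then 1 else 0)| =
      if x ≤ (ρ : ℕ) ∧ ((ρ : ℕ) : ℝ) < y then 1 else 0 := by
    intro ρ
    by_cases h1 : x ≤ (ρ : ℕ) <;> by_cases h2 : y ≤ (ρ : ℕ) <;>
      simp [h1, h2, not_lt.2, lt_of_not_ge]
    linarith
  simp_rw [h]
  rw [Finset.sum_boole]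
  have hcard : (Finset.univ.filter fun ρ : Fin N => x ≤ (ρ : ℕ) ∧ ((ρ : ℕ) : ℝ) < y).card ≤
      (Finset.Ico ⌈x⌉ ⌈y⌉).card := by
    refine Finset.card_le_card_of_injOn (fun ρ => ((ρ : ℕ) : ℤ)) ?_ ?_
    · intro ρ hρ
      simp only [Finset.coe_filter, Finset.mem_univ, true_and, Set.mem_ofPred_eq] at hρ
      simp only [Finset.coe_Ico, Set.mem_Ico]
      refine ⟨Int.ceil_le.2 (by exact_mod_cast hρ.1), Int.lt_ceil.2 (by exact_mod_cast hρ.2)⟩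
    · intro a _ b _ hab
      exact Fin.ext (by simpa using hab)
  rw [Int.card_Ico] at hcard
  have hle : ⌈x⌉ ≤ ⌈y⌉ := Int.ceil_mono hxy
  calc (((Finset.univ.filter fun ρ : Fin N => x ≤ (ρ : ℕ) ∧ ((ρ : ℕ) : ℝ) < y).card : ℕ) : ℝ)
      ≤ (((⌈y⌉ - ⌈x⌉).toNat : ℕ) : ℝ) := by exact_mod_cast hcard
    _ = ((⌈y⌉ - ⌈x⌉ : ℤ) : ℝ) := by
        exact_mod_cast congrArg (Int.cast (R := ℝ)) (Int.toNat_of_nonneg (sub_nonneg.2 hle))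
    _ ≤ |x - y| + 1 := by
        rw [abs_of_nonpos (by linarith)]
        push_cast
        linarith [Int.ceil_lt_add_one y, Int.le_ceil x]

/-- By AM-GM, |f| ≤ f²/(2√N) + √N/2, and 9/2 + 1/2 = 5. The 9 is the square of the bound in
`growth_pow_le`. -/
lemma expect_abs_le_of_sq {ι : Type*} [Fintype ι] [Nonempty ι] {f : ι → ℝ} {N : ℝ} (hN : 0 < N)
    (h : 𝔼 r, f r ^ 2 ≤ 9 * N) : 𝔼 r, |f r| ≤ 5 * √N := by
  have hs : 0 < √N := Real.sqrt_pos.2 hN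
  have hsq : √N * √N = N := Real.mul_self_sqrt hN.le
  have h1 : ∀ r, |f r| ≤ (1 / (2 * √N)) * f r ^ 2 + √N / 2 := by
    intro r
    have : 0 ≤ (1 / (2 * √N)) * (|f r| - √N) ^ 2 := by positivity
    have h2 : (1 / (2 * √N)) * (|f r| - √N) ^ 2 =
        (1 / (2 * √N)) * f r ^ 2 + √N / 2 - |f r| := by
      rw [← sq_abs (f r)]
      field_simp
      ring
    linarith
  calc 𝔼 r, |f r| ≤ 𝔼 r, ((1 / (2 * √N)) * f r ^ 2 + √N / 2) :=
        Finset.expect_le_expect fun r _ => h1 r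
    _ = (1 / (2 * √N)) * 𝔼 r, f r ^ 2 + √N / 2 := by
        rw [Finset.expect_add_distrib, ← Finset.mul_expect, Fintype.expect_const]
    _ ≤ (1 / (2 * √N)) * (9 * N) + √N / 2 := by gcongr
    _ = 5 * √N := by
        nth_rewrite 2 [← hsq]
        field_simp
        ring

/-! ### Mean motion of a card and concentration around it. -/

/-- The growth factor per insertion of the mean distances in a row of `n + 1` cards. -/
noncomputable def growth (n : ℕ) : ℝ := 1 + 1 / ((n : ℝ) + 1)

lemma one_le_growth (n : ℕ) : 1 ≤ growth n := by
  have : (0 : ℝ) ≤ 1 / ((n : ℝ) + 1) := by positivity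
  rw [growth]; linarith

lemma growth_pos (n : ℕ) : 0 < growth n := zero_lt_one.trans_le (one_le_growth n)

lemma growth_mul (n : ℕ) : growth n * ((n : ℝ) + 1) = (n : ℝ) + 1 + 1 := by
  rw [growth]
  field_simp

lemma growth_pow_le {i : ℕ} (hi : i ≤ n + 1) : growth n ^ i ≤ 3 := by
  calc growth n ^ i ≤ growth n ^ (n + 1) := pow_le_pow_right₀ (one_le_growth n) hi
    _ ≤ Real.exp (1 / ((n : ℝ) + 1)) ^ (n + 1) := by
        gcongr
        · exact (growth_pos n).le
        · rw [growth, add_comm]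
          exact Real.add_one_le_exp _
    _ = Real.exp 1 := by
        rw [← Real.exp_nat_mul]
        congr 1
        push_cast
        field_simp
    _ ≤ 3 := (Real.exp_one_lt_d9.trans (by norm_num)).le

/-- The mean motion of a card started in position `x`, when `a i ∈ {0, 1}` tells whether the card
removed at the `i`-th step was to its left. -/
noncomputable def drift (n : ℕ) (x : ℝ) (a : ℕ → ℝ) : ℕ → ℝ
  | 0 => x
  | i + 1 => growth n * (drift n x a i + 1 - a i) - 1

/-- Whether the card removed at time `t` was to the left of card `d`. -/
def leftOf (r : Fin (n + 1) → Fin (n + 1)) (d : Fin (n + 1)) (t : ℕ) : ℝ :=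
  if pos r t (Fin.ofNat (n + 1) t) < pos r t d then 1 else 0

lemma leftOf_val (r : Fin (n + 1) → Fin (n + 1)) (d i : Fin (n + 1)) :
    leftOf r d i = if pos r i i < pos r i d then 1 else 0 := by
  simp [leftOf]

lemma leftOf_update (r : Fin (n + 1) → Fin (n + 1)) (i ρ d : Fin (n + 1)) {t : ℕ} (ht : t ≤ i) :
    leftOf (Function.update r i ρ) d t = leftOf r d t := by
  simp only [leftOf, pos_update r i ρ _ ht]

lemma drift_congr {x : ℝ} {a a' : ℕ → ℝ} {i : ℕ} (h : ∀ l < i, a l = a' l) :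
    drift n x a i = drift n x a' i := by
  induction i with
  | zero => rfl
  | succ i ih => rw [drift, drift, ih fun l hl => h l (by omega), h i (by omega)]

/-- Given the past, only `r i` is random. It adds a Bernoulli displacement whose mean reproduces the
`drift` recursion, so the offset from m is multiplied by `growth n` and the variance grows by at
most 1. -/
lemma expect_sq_pos_step (r : Fin (n + 1) → Fin (n + 1)) {i d : Fin (n + 1)} (hid : d ≠ i)
    (m : ℝ) :
    𝔼 ρ, (((pos (Function.update r i ρ) ((i : ℕ) + 1) d : ℕ) : ℝ) -
        (growth n * (m + 1 - leftOf r d i) - 1)) ^ 2 ≤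
      growth n ^ 2 * (((pos r i d : ℕ) : ℝ) - m) ^ 2 + 1 := by
  have hx := (pos r i d).isLt
  have hN : ((n + 1 : ℕ) : ℝ) ≠ 0 := by positivity
  have hne : pos r i d ≠ pos r i i := fun h => hid ((stage r i)⁻¹.injective h)
  rcases lt_or_gt_of_ne hne with h | h
  · have ha : leftOf r d i = 0 := by rw [leftOf_val, if_neg h.le.not_gt]
    -- When the removed card was to the right of d, the pushing positions are ρ ≤ pos, hence pos + 1
    -- of them; in the other case they are ρ < pos, hence pos of them.
    have hL : (pos r i d : ℕ) + 1 ≤ n + 1 := hx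
    have key := expect_sq_add_ite (Nat.succ_pos n) hL
      (((pos r i d : ℕ) : ℝ) - (growth n * (m + 1 - leftOf r d i) - 1))
    refine le_trans (le_of_eq ?_) (key.trans (le_of_eq ?_))
    · refine Finset.expect_congr rfl fun ρ _ => ?_
      have h' : pos (Function.update r i ρ) i d < pos (Function.update r i ρ) i i := by
        rwa [pos_update _ _ _ _ le_rfl, pos_update _ _ _ _ le_rfl]
      rw [pos_succ_of_gt _ h', pos_update _ _ _ _ le_rfl, Function.update_self]
      by_cases hρ : ρ ≤ pos r i d
      · rw [if_pos hρ, if_pos (Nat.lt_succ_of_le hρ)]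
        push_cast
        ring
      · rw [if_neg hρ, if_neg fun h => hρ (Nat.lt_succ_iff.1 h)]
        ring
    · rw [ha, ← mul_pow]
      congr 2
      rw [growth]
      push_cast at hN ⊢
      field_simp
      ring
  · have ha : leftOf r d i = 1 := by rw [leftOf_val, if_pos h]
    have hL : (pos r i d : ℕ) ≤ n + 1 := hx.le
    have key := expect_sq_add_ite (Nat.succ_pos n) hL
      (((pos r i d : ℕ) : ℝ) - 1 - (growth n * (m + 1 - leftOf r d i) - 1))
    refine le_trans (le_of_eq ?_) (key.trans (le_of_eq ?_))
    · refine Finset.expect_congr rfl fun ρ _ => ?_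
      have h' : pos (Function.update r i ρ) i i < pos (Function.update r i ρ) i d := by
        rwa [pos_update _ _ _ _ le_rfl, pos_update _ _ _ _ le_rfl]
      rw [pos_succ_of_lt _ h', pos_update _ _ _ _ le_rfl, Function.update_self]
      by_cases hρ : ρ < pos r i d
      · rw [if_pos hρ, if_pos (Fin.lt_def.1 hρ)]
        ring
      · rw [if_neg hρ, if_neg fun h => hρ (Fin.lt_def.2 h), Nat.cast_sub (by rw [Fin.lt_def] at h; omega)]
        push_cast
        ring
    · rw [ha, ← mul_pow]
      congr 2
      rw [growth]
      push_cast at hN ⊢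
      field_simp
      ring

/-- Second moment of the deviation of a card from its mean motion. -/
lemma expect_sq_pos_sub_drift (d : Fin (n + 1)) (s : ℕ) :
    ∀ i, s + i ≤ n + 1 → (∀ l < i, s + l ≠ d) →
      𝔼 r : Fin (n + 1) → Fin (n + 1), (((pos r (s + i) d : ℕ) : ℝ) -
        drift n ((pos r s d : ℕ) : ℝ) (fun l => leftOf r d (s + l)) i) ^ 2 ≤
      i * growth n ^ (2 * i) := by
  intro i
  induction i with
  | zero => intro _ _; simp [drift]
  | succ i ih =>
    intro hi hd
    have ih := ih (by omega) fun l hl => hd l (by omega)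
    have hlt : s + i < n + 1 := by omega
    set j : Fin (n + 1) := ⟨s + i, hlt⟩ with hj
    have hdj : d ≠ j := fun h => hd i (by omega) (by rw [h])
    -- Resample the insertion at time s + i only: the position and the sides recorded up to that
    -- time do not change.
    rw [← expect_update _ j]
    have step : ∀ r : Fin (n + 1) → Fin (n + 1),
        𝔼 ρ, (((pos (Function.update r j ρ) (s + (i + 1)) d : ℕ) : ℝ) -
          drift n ((pos (Function.update r j ρ) s d : ℕ) : ℝ)
            (fun l => leftOf (Function.update r j ρ) d (s + l)) (i + 1)) ^ 2 ≤
        growth n ^ 2 * (((pos r (s + i) d : ℕ) : ℝ) -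
          drift n ((pos r s d : ℕ) : ℝ) (fun l => leftOf r d (s + l)) i) ^ 2 + 1 := by
      intro r
      refine le_trans (le_of_eq ?_) (expect_sq_pos_step r hdj
        (drift n ((pos r s d : ℕ) : ℝ) (fun l => leftOf r d (s + l)) i))
      refine Finset.expect_congr rfl fun ρ _ => ?_
      rw [pos_update r j ρ d (t := s) (by simp [hj]), drift,
        drift_congr (a' := fun l => leftOf r d (s + l))
          fun l hl => leftOf_update r j ρ d (by simp only [hj]; omega)]
      rw [leftOf_update r j ρ d (by simp [hj])]
      rfl
    refine (Finset.expect_le_expect fun r _ => step r).trans ?_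
    rw [Finset.expect_add_distrib, ← Finset.mul_expect, Fintype.expect_const]
    have h1 : 1 ≤ growth n ^ (2 * (i + 1)) := one_le_pow₀ (one_le_growth n)
    calc _ ≤ growth n ^ 2 * (i * growth n ^ (2 * i)) + growth n ^ (2 * (i + 1)) := by gcongr
      _ = _ := by push_cast; ring

lemma expect_abs_pos_sub_drift (d : Fin (n + 1)) (s i : ℕ) (hi : s + i ≤ n + 1)
    (hd : ∀ l < i, s + l ≠ d) :
    𝔼 r : Fin (n + 1) → Fin (n + 1), |((pos r (s + i) d : ℕ) : ℝ) -
        drift n ((pos r s d : ℕ) : ℝ) (fun l => leftOf r d (s + l)) i| ≤ 5 * √((n : ℝ) + 1) := by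
  refine expect_abs_le_of_sq (by positivity) ((expect_sq_pos_sub_drift d s i hi hd).trans ?_)
  have h3 := growth_pow_le (n := n) (i := i) (by omega)
  have h0 : 0 ≤ growth n ^ i := pow_nonneg (growth_pos n).le _
  have hi' : (i : ℝ) ≤ (n : ℝ) + 1 := by exact_mod_cast (by omega : i ≤ n + 1)
  calc (i : ℝ) * growth n ^ (2 * i) = i * (growth n ^ i) ^ 2 := by rw [← pow_mul, mul_comm 2 i]
    _ ≤ ((n : ℝ) + 1) * 3 ^ 2 := by gcongr
    _ = 9 * ((n : ℝ) + 1) := by ring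

/-- With all removals on the left, N is the fixed point of the recursion, and the distance to it is
multiplied by g at each step. -/
lemma drift_of_eq_one (x : ℝ) {a : ℕ → ℝ} {i : ℕ} (h : ∀ l < i, a l = 1) :
    drift n x a i = (n + 1) - (n + 1 - x) * growth n ^ i := by
  induction i with
  | zero => simp [drift]
  | succ i ih =>
    rw [drift, ih fun l hl => h l (by omega), h i (by omega), pow_succ]
    linear_combination growth_mul n

/-- After the first T steps removals come from the right, and the fixed point changes from N to -1.
-/
lemma drift_ite_lt (x : ℝ) (T i : ℕ) :
    drift n x (fun l => if l < T then 1 else 0) i =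
      (n + 1) * growth n ^ (1 + i - min T i) - (n + 1 - x) * growth n ^ i - 1 := by
  induction i with
  | zero =>
    simp [drift]
    linear_combination -growth_mul n
  | succ i ih =>
    rw [drift, ih]
    by_cases h : i < T
    · rw [if_pos h, min_eq_right (by omega), min_eq_right (by omega)]
      simp only [Nat.add_sub_cancel, pow_succ]
      linear_combination growth n * growth_mul n
    · rw [if_neg h, min_eq_left (by omega), min_eq_left (by omega),
        show 1 + (i + 1) - T = (1 + i - T) + 1 by omega]
      ring

/-- A discrepancy at step l is amplified by the i - l growth factors from that step on. -/
lemma abs_drift_sub_drift_le (x : ℝ) (a a' : ℕ → ℝ) (i : ℕ) :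
    |drift n x a i - drift n x a' i| ≤
      ∑ l ∈ Finset.range i, growth n ^ (i - l) * |a l - a' l| := by
  induction i with
  | zero => simp [drift]
  | succ i ih =>
    have h1 : drift n x a (i + 1) - drift n x a' (i + 1) =
        growth n * ((drift n x a i - drift n x a' i) - (a i - a' i)) := by
      rw [drift, drift]; ring
    rw [h1, abs_mul, abs_of_pos (growth_pos n), Finset.sum_range_succ]
    calc growth n * |drift n x a i - drift n x a' i - (a i - a' i)|
        ≤ growth n * (∑ l ∈ Finset.range i, growth n ^ (i - l) * |a l - a' l| +
            |a i - a' i|) := by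
          gcongr
          · exact (growth_pos n).le
          · exact (abs_sub _ _).trans (by gcongr)
      _ = _ := by
          rw [mul_add, Finset.mul_sum]
          congr 1
          · refine Finset.sum_congr rfl fun l hl => ?_
            rw [Nat.sub_add_comm (Finset.mem_range.1 hl).le]
            ring
          · simp

/-! ### The final position as a function of the insertion position. -/

/-- The number of unmoved cards expected to the left of card `k` when it is inserted in
position `ρ`. -/
noncomputable def unmoved (n k ρ : ℕ) : ℕ :=
  ⌊(n : ℝ) + 1 - k - (n + 1 - ρ) / growth n ^ k⌋₊

/-- The expected final position of card `k` when it is inserted in position `ρ`. -/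
noncomputable def target (n k ρ : ℕ) : ℝ :=
  drift n ρ (fun l => if l < unmoved n k ρ then 1 else 0) (n - k)

/-- The l-th card removed after k is k + 1 + l; the right side says that its mean position at time k
is at most ρ. Truncation of the floor at 0 is harmless because l + 1 > 0. -/
lemma lt_unmoved_iff (k ρ l : ℕ) :
    l < unmoved n k ρ ↔
      ((n : ℝ) + 1) - (n + 1 - ((k + 1 + l : ℕ) : ℝ)) * growth n ^ k ≤ (ρ : ℝ) := by
  have hq : 0 < growth n ^ k := pow_pos (growth_pos n) k
  rw [unmoved, ← Nat.succ_le_iff, Nat.succ_eq_add_one, Nat.le_floor_iff' (by omega)]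
  have : ((n : ℝ) + 1 - ρ) / growth n ^ k ≤ (n : ℝ) + 1 - k - (l + 1) ↔
      (n : ℝ) + 1 - ρ ≤ ((n : ℝ) + 1 - k - (l + 1)) * growth n ^ k := div_le_iff₀ hq
  push_cast
  constructor
  · intro h
    have := this.1 (by linarith)
    nlinarith
  · intro h
    have := this.2 (by nlinarith)
    linarith

/-- The position of an unmoved card concentrates. -/
lemma expect_abs_pos_sub_of_lt {k t : Fin (n + 1)} (hkt : k < t) :
    𝔼 r : Fin (n + 1) → Fin (n + 1), |((pos r k t : ℕ) : ℝ) -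
      (((n : ℝ) + 1) - (n + 1 - ((t : ℕ) : ℝ)) * growth n ^ (k : ℕ))| ≤ 5 * √((n : ℝ) + 1) := by
  rw [Fin.lt_def] at hkt
  have h := expect_abs_pos_sub_drift t 0 k (by omega) (by omega)
  refine le_trans (le_of_eq (Finset.expect_congr rfl fun r _ => ?_)) h
  rw [drift_of_eq_one, pos_zero, zero_add]
  intro l hl
  have hl' : l < n + 1 := by omega
  rw [zero_add]
  have := leftOf_val r t ⟨l, hl'⟩
  simp only at this
  rw [this, if_pos]
  exact pos_lt_pos r le_rfl (by rw [Fin.lt_def]; simp; omega)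

/-- Both indicators compare `r k` with a threshold: the true position of t at time k, or its mean p.
The true position is independent of `r k`, so the error is (E|pos - p| + 1)/N, and E|pos - p| ≤ 5√N.
-/
lemma expect_abs_leftOf_sub_le {k t : Fin (n + 1)} (l : ℕ) (ht : (t : ℕ) = k + 1 + l) :
    𝔼 r : Fin (n + 1) → Fin (n + 1),
      |leftOf r k t - (if l < unmoved n k (r k) then 1 else 0)| ≤ 6 / √((n : ℝ) + 1) := by
  have hkt : k < t := by rw [Fin.lt_def]; omega
  have hs : 0 < √((n : ℝ) + 1) := Real.sqrt_pos.2 (by positivity)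
  have hsq : √((n : ℝ) + 1) * √((n : ℝ) + 1) = n + 1 := Real.mul_self_sqrt (by positivity)
  have hs1 : 1 ≤ √((n : ℝ) + 1) := Real.one_le_sqrt.2 (by linarith [Nat.cast_nonneg (α := ℝ) n])
  set p : ℝ := ((n : ℝ) + 1) - (n + 1 - ((t : ℕ) : ℝ)) * growth n ^ (k : ℕ) with hp
  rw [← expect_update _ k]
  have h1 : ∀ r : Fin (n + 1) → Fin (n + 1), 𝔼 ρ, |leftOf (Function.update r k ρ) k t -
      (if l < unmoved n k (Function.update r k ρ k) then 1 else 0)| ≤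
      (|((pos r k t : ℕ) : ℝ) - p| + 1) / ((n + 1 : ℕ) : ℝ) := by
    intro r
    refine le_trans (le_of_eq (Finset.expect_congr rfl fun ρ _ => ?_))
      (expect_abs_ite_sub_ite_le (N := n + 1) ((pos r k t : ℕ) : ℝ) p)
    rw [leftOf_val, Function.update_self]
    simp only [pos_lt_pos_iff_le _ hkt, lt_unmoved_iff, Function.update_self,
      pos_update r k ρ t le_rfl, ← ht, ← hp, Fin.le_def, Nat.cast_le]
  refine (Finset.expect_le_expect fun r _ => h1 r).trans ?_
  rw [← Finset.expect_div, Finset.expect_add_distrib, Fintype.expect_const]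
  have h2 := expect_abs_pos_sub_of_lt hkt
  rw [← hp] at h2
  calc _ ≤ (5 * √((n : ℝ) + 1) + √((n : ℝ) + 1)) / ((n + 1 : ℕ) : ℝ) := by gcongr
    _ = 6 / √((n : ℝ) + 1) := by
        push_cast
        nth_rewrite 3 [← hsq]
        field_simp
        ring

/-- The final position of card `k` is close to a function of the position in which it was
inserted. -/
lemma expect_abs_pos_sub_target_le (k : Fin (n + 1)) :
    𝔼 r : Fin (n + 1) → Fin (n + 1), |((pos r (n + 1) k : ℕ) : ℝ) - target n k (r k)| ≤
      23 * √((n : ℝ) + 1) := by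
  have hs : 0 < √((n : ℝ) + 1) := Real.sqrt_pos.2 (by positivity)
  have hsq : √((n : ℝ) + 1) * √((n : ℝ) + 1) = n + 1 := Real.mul_self_sqrt (by positivity)
  have hk := k.isLt
  have h1 := expect_abs_pos_sub_drift k (k + 1) (n - k) (by omega) (by omega)
  rw [show (k : ℕ) + 1 + (n - k) = n + 1 by omega] at h1
  have h2 : ∀ r : Fin (n + 1) → Fin (n + 1),
      |((pos r (n + 1) k : ℕ) : ℝ) - target n k (r k)| ≤
      |((pos r (n + 1) k : ℕ) : ℝ) - drift n ((pos r (k + 1) k : ℕ) : ℝ)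
        (fun l => leftOf r k (k + 1 + l)) (n - k)| +
      ∑ l ∈ Finset.range (n - k), 3 *
        |leftOf r k (k + 1 + l) - (if l < unmoved n k (r k) then 1 else 0)| := by
    intro r
    refine (abs_sub_le _ (drift n ((pos r (k + 1) k : ℕ) : ℝ)
        (fun l => leftOf r k (k + 1 + l)) (n - k)) _).trans ?_
    gcongr
    rw [pos_succ_self, target]
    refine (abs_drift_sub_drift_le _ _ _ _).trans ?_
    gcongr with l hl
    exact growth_pow_le (by omega)
  refine (Finset.expect_le_expect fun r _ => h2 r).trans ?_
  rw [Finset.expect_add_distrib, Finset.expect_sum_comm]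
  -- Each of at most N wrong sides costs 3 · 6/√N, in all 18√N; the fluctuation term adds 5√N.
  have h3 : ∀ l ∈ Finset.range (n - k), 𝔼 r : Fin (n + 1) → Fin (n + 1), 3 *
      |leftOf r k (k + 1 + l) - (if l < unmoved n k (r k) then 1 else 0)| ≤
      18 / √((n : ℝ) + 1) := by
    intro l hl
    have hl := Finset.mem_range.1 hl
    have := expect_abs_leftOf_sub_le (k := k) (t := ⟨k + 1 + l, by omega⟩) l rfl
    rw [← Finset.mul_expect]
    calc _ ≤ 3 * (6 / √((n : ℝ) + 1)) := by gcongr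
      _ = _ := by ring
  have h4 := Finset.sum_le_sum h3
  rw [Finset.sum_const, Finset.card_range, nsmul_eq_mul] at h4
  have h5 : ((n - k : ℕ) : ℝ) ≤ (n : ℝ) + 1 := by exact_mod_cast (by omega : n - k ≤ n + 1)
  have h6 : ((n - k : ℕ) : ℝ) * (18 / √((n : ℝ) + 1)) ≤ 18 * √((n : ℝ) + 1) := by
    calc _ ≤ ((n : ℝ) + 1) * (18 / √((n : ℝ) + 1)) := by gcongr
      _ = _ := by
        nth_rewrite 1 [← hsq]
        field_simp
  linarith

/-! ### Scaling limit of the target. -/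

/-- A single formula for both branches, so that limits, continuity and monotonicity need no gluing
at the breakpoint. -/
lemma quantile_eq (b y : ℝ) :
    quantile b y = Real.exp (min ((1 - y) * Real.exp (-b)) (1 - b)) -
      (1 - y) * Real.exp (1 - b) := by
  have h : y ≤ 1 - (1 - b) * Real.exp b ↔ 1 - b ≤ (1 - y) * Real.exp (-b) := by
    rw [Real.exp_neg, ← div_eq_mul_inv, le_div_iff₀ (Real.exp_pos b)]
    constructor <;> intro h <;> linarith
  rw [quantile]
  split_ifs with hy
  · rw [min_eq_right (h.1 hy)]
    ring
  · rw [min_eq_left (le_of_not_ge (mt h.2 hy))]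

lemma tendsto_growth_pow {e : ℕ → ℕ} {l : ℝ}
    (h : Tendsto (fun n => (e n : ℝ) / ((n : ℝ) + 1)) atTop (𝓝 l)) :
    Tendsto (fun n => growth n ^ e n) atTop (𝓝 (Real.exp l)) := by
  have h1 : Tendsto (fun n : ℕ => ((n : ℝ) + 1) * Real.log (1 + 1 / ((n : ℝ) + 1)))
      atTop (𝓝 1) :=
    (Real.tendsto_mul_log_one_add_div_atTop 1).comp
      (tendsto_atTop_add_const_right _ 1 tendsto_natCast_atTop_atTop)
  have h2 := (Real.continuous_exp.tendsto _).comp (h.mul h1)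
  rw [mul_one] at h2
  refine h2.congr fun n => ?_
  have hn : (n : ℝ) + 1 ≠ 0 := by positivity
  rw [Function.comp_apply, ← mul_assoc, div_mul_cancel₀ _ hn, Real.exp_nat_mul,
    ← growth, Real.exp_log (growth_pos n)]

lemma tendsto_floor_div {z : ℕ → ℝ} {l : ℝ}
    (h : Tendsto (fun n => z n / ((n : ℝ) + 1)) atTop (𝓝 l)) :
    Tendsto (fun n => (⌊z n⌋₊ : ℝ) / ((n : ℝ) + 1)) atTop (𝓝 (max l 0)) := by
  have h1 : Tendsto (fun n => max (z n / ((n : ℝ) + 1)) 0) atTop (𝓝 (max l 0)) :=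
    h.max tendsto_const_nhds
  have h2 := h1.sub tendsto_one_div_add_atTop_nhds_zero_nat
  rw [sub_zero] at h2
  refine tendsto_of_tendsto_of_tendsto_of_le_of_le h2 h1 (fun n => ?_) (fun n => ?_)
  · have hn : (0 : ℝ) < (n : ℝ) + 1 := by positivity
    have h3 : max (z n / ((n : ℝ) + 1)) 0 ≤ (⌊z n⌋₊ : ℝ) / ((n : ℝ) + 1) + 1 / ((n : ℝ) + 1) := by
      rw [← add_div]
      exact max_le (by gcongr; exact (Nat.lt_floor_add_one _).le) (by positivity)
    simp only
    linarith
  · have hn : (0 : ℝ) < (n : ℝ) + 1 := by positivity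
    rcases le_total 0 (z n) with hz | hz
    · exact le_max_of_le_left (by gcongr; exact Nat.floor_le hz)
    · exact le_max_of_le_right (by simp [Nat.floor_of_nonpos hz])

lemma tendsto_target {k ρ : ℕ → ℕ} {b u : ℝ} (hk : ∀ n, k n ≤ n) (hu1 : u ≤ 1)
    (hb : Tendsto (fun n => (k n : ℝ) / ((n : ℝ) + 1)) atTop (𝓝 b))
    (hu : Tendsto (fun n => (ρ n : ℝ) / ((n : ℝ) + 1)) atTop (𝓝 u)) :
    Tendsto (fun n => target n (k n) (ρ n) / ((n : ℝ) + 1)) atTop (𝓝 (quantile b u)) := by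
  have hinv := tendsto_one_div_add_atTop_nhds_zero_nat (𝕜 := ℝ)
  have hb1 : b ≤ 1 := le_of_tendsto' hb fun n =>
    div_le_one_of_le₀ (by have := hk n; norm_cast; omega) (by positivity)
  have hi : Tendsto (fun n => ((n - k n : ℕ) : ℝ) / ((n : ℝ) + 1)) atTop (𝓝 (1 - b)) := by
    have h1 := (tendsto_const_nhds (x := (1 : ℝ))).sub hb |>.sub hinv
    rw [sub_zero] at h1
    refine h1.congr fun n => ?_
    rw [Nat.cast_sub (hk n)]
    field_simp
    ring
  have hw : Tendsto (fun n : ℕ => ((n : ℝ) + 1 - k n - (n + 1 - ρ n) / growth n ^ k n) /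
      ((n : ℝ) + 1)) atTop (𝓝 (1 - b - (1 - u) * Real.exp (-b))) := by
    have h1 := ((tendsto_const_nhds (x := (1 : ℝ))).sub hb).sub
      (((tendsto_const_nhds (x := (1 : ℝ))).sub hu).div (tendsto_growth_pow hb)
        (Real.exp_ne_zero b))
    rw [Real.exp_neg, ← div_eq_mul_inv]
    refine h1.congr fun n => ?_
    have := (pow_pos (growth_pos n) (k n)).ne'
    simp only [Pi.div_apply]
    field_simp
  have hT : Tendsto (fun n => (unmoved n (k n) (ρ n) : ℝ) / ((n : ℝ) + 1)) atTop
      (𝓝 (max (1 - b - (1 - u) * Real.exp (-b)) 0)) := tendsto_floor_div hw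
  -- The exponent from `drift_ite_lt`: 1 plus the number of later removals to the right of the card.
  have he : Tendsto (fun n => ((1 + (n - k n) - min (unmoved n (k n) (ρ n)) (n - k n) : ℕ) : ℝ) /
      ((n : ℝ) + 1)) atTop (𝓝 (min ((1 - u) * Real.exp (-b)) (1 - b))) := by
    have h1 := (hinv.add hi).sub (hT.min hi)
    have h2 : 0 + (1 - b) - min (max (1 - b - (1 - u) * Real.exp (-b)) 0) (1 - b) =
        min ((1 - u) * Real.exp (-b)) (1 - b) := by
      have h0 : 0 ≤ (1 - u) * Real.exp (-b) :=
        mul_nonneg (sub_nonneg.2 hu1) (Real.exp_pos _).le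
      rcases le_total ((1 - u) * Real.exp (-b)) (1 - b) with h | h
      · rw [min_eq_left h, max_eq_left (by linarith), min_eq_left (by linarith)]
        ring
      · rw [min_eq_right h, max_eq_right (by linarith), min_eq_left (by linarith)]
        ring
    rw [h2] at h1
    refine h1.congr fun n => ?_
    rw [Nat.cast_sub (show min (unmoved n (k n) (ρ n)) (n - k n) ≤ 1 + (n - k n) by omega),
      Nat.cast_add, Nat.cast_one, Nat.cast_min, sub_div, add_div, min_div_div_right (by positivity)]
  have h1 := ((tendsto_growth_pow he).sub
    (((tendsto_const_nhds (x := (1 : ℝ))).sub hu).mul (tendsto_growth_pow hi))).sub hinv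
  rw [sub_zero, ← quantile_eq] at h1
  refine h1.congr fun n => ?_
  rw [target, drift_ite_lt]
  field_simp

/-! ### The limit law: G_b, its inverse and its density. -/

/-- In terms of w = (1 - y) e^(-b), G_b is exp (min w (1 - b)) - e w. It decreases strictly in w,
since exp is strictly convex with slope at most e on (-∞, 1 - b], where b ≥ 0 enters. -/
lemma strictMono_quantile {b : ℝ} (hb : 0 ≤ b) : StrictMono (quantile b) := by
  intro y y' hy
  rw [quantile_eq, quantile_eq]
  have he : Real.exp (1 - b) = Real.exp 1 * Real.exp (-b) := by rw [← Real.exp_add]; ring_nf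
  have hw : (1 - y') * Real.exp (-b) < (1 - y) * Real.exp (-b) :=
    mul_lt_mul_of_pos_right (by linarith) (Real.exp_pos _)
  set w := (1 - y) * Real.exp (-b) with hwdef
  set w' := (1 - y') * Real.exp (-b) with hwdef'
  rw [he, show (1 - y) * (Real.exp 1 * Real.exp (-b)) = Real.exp 1 * w by rw [hwdef]; ring,
    show (1 - y') * (Real.exp 1 * Real.exp (-b)) = Real.exp 1 * w' by rw [hwdef']; ring]
  have he1 : 0 < Real.exp 1 := Real.exp_pos 1
  have hle : min w' (1 - b) ≤ min w (1 - b) := min_le_min_right _ hw.le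
  rcases hle.eq_or_lt with h | h
  · rw [h]
    nlinarith
  · have h1 : min w (1 - b) - min w' (1 - b) ≤ w - w' := by
      have hw' : w' < 1 - b := by
        by_contra hcon
        rw [min_eq_right (not_lt.1 hcon)] at h
        exact absurd (min_le_right w (1 - b)) h.not_ge
      rw [min_eq_left hw'.le]
      linarith [min_le_left w (1 - b)]
    have h2 := Real.add_one_lt_exp (x := min w' (1 - b) - min w (1 - b)) (by linarith)
    have h3 : Real.exp (min w (1 - b)) ≤ Real.exp 1 :=
      Real.exp_le_exp.2 ((min_le_right _ _).trans (by linarith))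
    have h4 : Real.exp (min w' (1 - b)) =
        Real.exp (min w (1 - b)) * Real.exp (min w' (1 - b) - min w (1 - b)) := by
      rw [← Real.exp_add]; ring_nf
    have h5 : 0 < Real.exp (min w (1 - b)) := Real.exp_pos _
    rw [h4]
    nlinarith

lemma continuous_quantile (b : ℝ) : Continuous (quantile b) := by
  rw [funext (quantile_eq b)]
  fun_prop

lemma quantile_zero (b : ℝ) : quantile b 0 = 0 := by
  rw [quantile_eq, sub_zero, one_mul, one_mul,
    min_eq_right (by linarith [Real.add_one_le_exp (-b)]), sub_self]

lemma quantile_one {b : ℝ} (hb : b ≤ 1) : quantile b 1 = 1 := by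
  rw [quantile_eq]
  simp [hb]

lemma quantile_mem_Icc_iff {b : ℝ} (hb : b ∈ Set.Icc (0 : ℝ) 1) {y :
    ℝ} : quantile b y ∈ Set.Icc (0 : ℝ) 1 ↔ y ∈ Set.Icc (0 : ℝ) 1 := by
  have hm := strictMono_quantile hb.1
  rw [Set.mem_Icc, Set.mem_Icc, ← hm.le_iff_le (a := 0) (b := y), ← hm.le_iff_le (a := y) (b := 1),
    quantile_zero, quantile_one hb.2]

lemma bijOn_quantile {b : ℝ} (hb : b ∈ Set.Icc (0 : ℝ) 1) :
    Set.BijOn (quantile b) (Set.Icc 0 1) (Set.Icc 0 1) := by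
  refine ⟨fun y hy => (quantile_mem_Icc_iff hb).2 hy, (strictMono_quantile hb.1).injective.injOn, ?_⟩
  have := intermediate_value_Icc zero_le_one (continuous_quantile b).continuousOn
  rwa [quantile_zero, quantile_one hb.2] at this

lemma invOn_distFun {b : ℝ} (hb : b ∈ Set.Icc (0 : ℝ) 1) :
    Set.InvOn (distFun b) (quantile b) (Set.Icc 0 1) (Set.Icc 0 1) :=
  (bijOn_quantile hb).invOn_invFunOn

lemma bijOn_distFun {b : ℝ} (hb : b ∈ Set.Icc (0 : ℝ) 1) :
    Set.BijOn (distFun b) (Set.Icc 0 1) (Set.Icc 0 1) :=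
  (bijOn_quantile hb).symm (invOn_distFun hb).symm

lemma strictMonoOn_distFun {b : ℝ} (hb : b ∈ Set.Icc (0 : ℝ) 1) :
    StrictMonoOn (distFun b) (Set.Icc 0 1) := by
  intro x hx y hy hxy
  rwa [← (strictMono_quantile hb.1).lt_iff_lt, (invOn_distFun hb).2 hx, (invOn_distFun hb).2 hy]

lemma exists_hasDerivAt_quantile {b : ℝ} (hb : b ∈ Set.Icc (0 : ℝ) 1) {y : ℝ}
    (hy : y ≠ 1 - (1 - b) * Real.exp b) :
    ∃ d, d ≠ 0 ∧ HasDerivAt (quantile b) d y := by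
  rcases lt_or_gt_of_ne hy with h | h
  · refine ⟨Real.exp (1 - b), Real.exp_ne_zero _, ?_⟩
    have h1 : HasDerivAt (fun y => y * Real.exp (1 - b)) (1 * Real.exp (1 - b)) y :=
      (hasDerivAt_id y).mul_const _
    rw [one_mul] at h1
    refine h1.congr_of_eventuallyEq ?_
    filter_upwards [Iio_mem_nhds h] with z hz
    rw [quantile, if_pos (le_of_lt hz)]
  · have h1 : HasDerivAt (fun y => Real.exp ((1 - y) * Real.exp (-b)) - (1 - y) * Real.exp (1 - b))
        (Real.exp ((1 - y) * Real.exp (-b)) * ((-1) * Real.exp (-b)) - (-1) * Real.exp (1 - b)) y :=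
      ((((hasDerivAt_id y).const_sub 1).mul_const _).exp).sub
        (((hasDerivAt_id y).const_sub 1).mul_const _)
    refine ⟨_, ?_, h1.congr_of_eventuallyEq ?_⟩
    · have he : Real.exp (1 - b) = Real.exp 1 * Real.exp (-b) := by rw [← Real.exp_add]; ring_nf
      have hlt : Real.exp ((1 - y) * Real.exp (-b)) < Real.exp 1 := by
        refine Real.exp_lt_exp.2 ?_
        have h2 : (1 - y) * Real.exp (-b) < 1 - b := by
          rw [Real.exp_neg, ← div_eq_mul_inv, div_lt_iff₀ (Real.exp_pos b)]
          linarith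
        linarith [hb.1]
      rw [he]
      have := mul_pos (sub_pos.2 hlt) (Real.exp_pos (-b))
      nlinarith
    · filter_upwards [Ioi_mem_nhds h] with z hz
      rw [quantile, if_neg (not_le_of_gt hz)]

/-- Inverse function rule. Continuity of the inverse comes from monotonicity and surjectivity; only
the image of the breakpoint has to be avoided. -/
lemma hasDerivAt_distFun {b : ℝ} (hb : b ∈ Set.Icc (0 : ℝ) 1) {x : ℝ}
    (hx : x ∈ Set.Ioo (0 : ℝ) 1)
    (hne : x ≠ quantile b (1 - (1 - b) * Real.exp b)) :
    HasDerivAt (distFun b) (density b x) x := by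
  have hx' := Set.Ioo_subset_Icc_self hx
  have hnhds : Set.Icc (0 : ℝ) 1 ∈ 𝓝 x := Icc_mem_nhds hx.1 hx.2
  have hm := strictMono_quantile hb.1
  have hQ : quantile b (distFun b x) = x := (invOn_distFun hb).2 hx'
  have h0 : 0 < distFun b x := by
    rw [← hm.lt_iff_lt, hQ, quantile_zero]
    exact hx.1
  have h1 : distFun b x < 1 := by
    rw [← hm.lt_iff_lt, hQ, quantile_one hb.2]
    exact hx.2
  obtain ⟨d, hd, hder⟩ := exists_hasDerivAt_quantile hb
    (fun h => hne (by rw [← h, hQ]))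
  have hcont : ContinuousAt (distFun b) x := by
    refine (strictMonoOn_distFun hb).continuousAt_of_image_mem_nhds hnhds ?_
    rw [(bijOn_distFun hb).image_eq]
    exact Icc_mem_nhds h0 h1
  have h2 := HasDerivAt.of_local_left_inverse hcont hder hd
    (by filter_upwards [hnhds] with y hy using (invOn_distFun hb).2 hy)
  rwa [density, Set.indicator_of_mem hx', derivWithin_of_mem_nhds hnhds, h2.deriv]

lemma density_nonneg {b : ℝ} (hb : b ∈ Set.Icc (0 : ℝ) 1) (x : ℝ) : 0 ≤ density b x :=
  Set.indicator_nonneg (fun _ _ => (strictMonoOn_distFun hb).monotoneOn.derivWithin_nonneg) x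

lemma aemeasurable_density (b : ℝ) : AEMeasurable (density b) := by
  refine ⟨(Set.Icc (0 : ℝ) 1).indicator (deriv (distFun b)),
    (measurable_deriv _).indicator measurableSet_Icc, ?_⟩
  have h : ∀ a : ℝ, ∀ᵐ x : ℝ, x ≠ a := fun a => by simp [ae_iff]
  filter_upwards [h 0, h 1] with x h0 h1
  by_cases hx : x ∈ Set.Icc (0 : ℝ) 1
  · rw [density, Set.indicator_of_mem hx, Set.indicator_of_mem hx, derivWithin_of_mem_nhds
      (Icc_mem_nhds (lt_of_le_of_ne hx.1 h0.symm) (lt_of_le_of_ne hx.2 h1))]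
  · rw [density, Set.indicator_of_notMem hx, Set.indicator_of_notMem hx]

/-- `density b` is the density of the image of the uniform distribution under `quantile b`. -/
lemma map_quantile {b : ℝ} (hb : b ∈ Set.Icc (0 : ℝ) 1) :
    (volume.restrict (Set.Ico (0 : ℝ) 1)).map (quantile b) =
      volume.withDensity fun x => ENNReal.ofReal (density b x) := by
  have hmeas : Measurable (quantile b) := (continuous_quantile b).measurable
  ext A hA
  rw [Measure.map_apply hmeas hA, Measure.restrict_apply (hmeas hA), withDensity_apply _ hA]
  set y₀ := 1 - (1 - b) * Real.exp b with hy₀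
  set S : Set ℝ := Set.Ioo 0 1 \ {quantile b y₀} with hS
  have hSmeas : MeasurableSet S := measurableSet_Ioo.diff (measurableSet_singleton _)
  have hSsub : S ⊆ Set.Icc 0 1 := Set.sdiff_subset.trans Set.Ioo_subset_Icc_self
  -- Change of variables along F_b off the endpoints and the image of the breakpoint, all of which
  -- are null.
  have key := lintegral_image_eq_lintegral_abs_deriv_mul (s := A ∩ S) (hA.inter hSmeas)
    (f := distFun b) (f' := density b)
    (fun x hx => (hasDerivAt_distFun hb hx.2.1 hx.2.2).hasDerivWithinAt)
    ((bijOn_distFun hb).injOn.mono (Set.inter_subset_right.trans hSsub)) 1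
  simp only [Pi.one_apply, mul_one, setLIntegral_one, abs_of_nonneg (density_nonneg hb _)] at key
  have h : ∀ a : ℝ, ∀ᵐ x : ℝ, x ≠ a := fun a => by simp [ae_iff]
  have hleft : volume (quantile b ⁻¹' A ∩ Set.Ico 0 1) = volume (distFun b '' (A ∩ S)) := by
    refine measure_congr ?_
    filter_upwards [h 0, h 1, h y₀] with y hy0 hy1 hyy
    refine propext ⟨fun hy => ?_, ?_⟩
    · have hy' : y ∈ Set.Icc (0 : ℝ) 1 := ⟨hy.2.1, hy.2.2.le⟩
      have hm := strictMono_quantile hb.1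
      refine ⟨quantile b y, ⟨hy.1, ⟨?_, ?_⟩, fun heq => hyy (hm.injective heq)⟩,
        (invOn_distFun hb).1 hy'⟩
      · rw [← quantile_zero b]
        exact hm (lt_of_le_of_ne hy'.1 hy0.symm)
      · rw [← quantile_one hb.2]
        exact hm hy.2.2
    · rintro ⟨x, ⟨hxA, hxS⟩, rfl⟩
      have hF := (bijOn_distFun hb).mapsTo (hSsub hxS)
      refine ⟨?_, hF.1, lt_of_le_of_ne hF.2 hy1⟩
      rw [Set.mem_preimage, (invOn_distFun hb).2 (hSsub hxS)]
      exact hxA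
  rw [hleft, key, ← lintegral_indicator (hA.inter hSmeas), ← lintegral_indicator hA]
  refine lintegral_congr_ae ?_
  filter_upwards [h 0, h 1, h (quantile b y₀)] with x hx0 hx1 hxx
  by_cases hxA : x ∈ A
  · rw [Set.indicator_of_mem hxA]
    by_cases hxS : x ∈ S
    · rw [Set.indicator_of_mem (show x ∈ A ∩ S from ⟨hxA, hxS⟩)]
    · rw [Set.indicator_of_notMem fun h => hxS h.2, density, Set.indicator_of_notMem,
        ENNReal.ofReal_zero]
      exact fun hx => hxS ⟨⟨lt_of_le_of_ne hx.1 hx0.symm, lt_of_le_of_ne hx.2 hx1⟩, hxx⟩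
  · rw [Set.indicator_of_notMem hxA, Set.indicator_of_notMem fun h => hxA h.1]

lemma isProbabilityMeasure_density {b : ℝ} (hb : b ∈ Set.Icc (0 : ℝ) 1) :
    IsProbabilityMeasure (volume.withDensity fun x => ENNReal.ofReal (density b x)) := by
  have : IsProbabilityMeasure (volume.restrict (Set.Ico (0 : ℝ) 1)) := ⟨by simp⟩
  rw [← map_quantile hb]
  exact Measure.isProbabilityMeasure_map (continuous_quantile b).aemeasurable

lemma integrable_density {b : ℝ} (hb : b ∈ Set.Icc (0 : ℝ) 1) : Integrable (density b) := by
  rw [← lintegral_ofReal_ne_top_iff_integrable (aemeasurable_density b).aestronglyMeasurable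
    (Eventually.of_forall (density_nonneg hb))]
  have := (isProbabilityMeasure_density hb).measure_univ
  rw [withDensity_apply _ .univ, setLIntegral_univ] at this
  simp [this]

/-- A product of measures with densities has the product density. -/
lemma pi_withDensity_ofReal {ι : Type*} [Fintype ι] {f : ι → ℝ → ℝ} (hf : ∀ j, Integrable (f j))
    (hf0 : ∀ j x, 0 ≤ f j x) :
    Measure.pi (fun j => volume.withDensity fun x => ENNReal.ofReal (f j x)) =
      volume.withDensity fun x : ι → ℝ => ENNReal.ofReal (∏ j, f j (x j)) := by
  have hfin : ∀ j, IsFiniteMeasure (volume.withDensity fun x => ENNReal.ofReal (f j x)) :=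
    fun j => isFiniteMeasure_withDensity_ofReal (hf j).2
  -- It is enough to compare on boxes, where the integral of the product factorises.
  refine Measure.pi_eq fun s hs => ?_
  rw [withDensity_apply _ (.univ_pi hs), volume_pi, Measure.restrict_pi_pi,
    ← ofReal_integral_eq_lintegral_ofReal, integral_fintype_prod_eq_prod,
    ENNReal.ofReal_prod_of_nonneg fun j _ => integral_nonneg (hf0 j)]
  · refine Finset.prod_congr rfl fun j _ => ?_
    rw [withDensity_apply _ (hs j), ofReal_integral_eq_lintegral_ofReal (hf j).integrableOn
      (Eventually.of_forall (hf0 j))]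
  · exact Integrable.fintype_prod_dep fun j => (hf j).integrableOn
  · exact Eventually.of_forall fun x => Finset.prod_nonneg fun j _ => hf0 j _

/-! ### Realising the insertion positions on a fixed unit cube. -/

/-- The uniform distribution on `[0, 1)`. -/
noncomputable def unitUniform : Measure ℝ := volume.restrict (Set.Ico 0 1)

instance : IsProbabilityMeasure unitUniform := ⟨by simp [unitUniform]⟩

/-- The index of the interval of length `1 / (n + 1)` containing `u ∈ [0, 1)`. -/
noncomputable def bin (n : ℕ) (u : ℝ) : Fin (n + 1) := Fin.ofNat (n + 1) ⌊((n : ℝ) + 1) * u⌋₊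

lemma measurable_bin (n : ℕ) : Measurable (bin n) :=
  (Measurable.of_discrete (f := Fin.ofNat (n + 1))).comp
    (Nat.measurable_floor.comp (measurable_const_mul _))

lemma val_bin {u : ℝ} (hu : u ∈ Set.Ico (0 : ℝ) 1) :
    (bin n u : ℕ) = ⌊((n : ℝ) + 1) * u⌋₊ := by
  have hn : (0 : ℝ) < (n : ℝ) + 1 := by positivity
  rw [bin, Fin.val_ofNat, Nat.mod_eq_of_lt]
  rw [Nat.floor_lt (mul_nonneg hn.le hu.1)]
  push_cast
  nlinarith [hu.2]

lemma unitUniform_bin_preimage (i : Fin (n + 1)) :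
    unitUniform (bin n ⁻¹' {i}) = ENNReal.ofReal (1 / ((n : ℝ) + 1)) := by
  have hn : (0 : ℝ) < (n : ℝ) + 1 := by positivity
  rw [unitUniform, Measure.restrict_apply (measurable_bin n (measurableSet_singleton i))]
  have h : bin n ⁻¹' {i} ∩ Set.Ico 0 1 =
      Set.Ico (((i : ℕ) : ℝ) / ((n : ℝ) + 1)) ((((i : ℕ) : ℝ) + 1) / ((n : ℝ) + 1)) := by
    ext u
    rw [Set.mem_inter_iff, Set.mem_preimage, Set.mem_singleton_iff, Set.mem_Ico, Set.mem_Ico,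
      div_le_iff₀ hn, lt_div_iff₀ hn, mul_comm u]
    constructor
    · rintro ⟨hi, hu⟩
      rw [← hi, val_bin hu]
      exact ⟨Nat.floor_le (mul_nonneg hn.le hu.1), Nat.lt_floor_add_one _⟩
    · rintro ⟨h1, h2⟩
      have hi : ((i : ℕ) : ℝ) + 1 ≤ (n : ℝ) + 1 := by exact_mod_cast i.isLt
      have hu : u ∈ Set.Ico (0 : ℝ) 1 :=
        ⟨nonneg_of_mul_nonneg_right ((Nat.cast_nonneg _).trans h1) hn, by
          by_contra hcon
          nlinarith [not_lt.1 hcon]⟩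
      refine ⟨Fin.ext ?_, hu⟩
      rw [val_bin hu, Nat.floor_eq_iff (mul_nonneg hn.le hu.1)]
      exact ⟨h1, h2⟩
  rw [h, Real.volume_Ico]
  congr 1
  field_simp
  ring

/-- Averaging over functions into `Fin (n + 1)` as an integral over the unit cube. -/
lemma integral_bin {ι : Type*} [Fintype ι] [DecidableEq ι] (g : (ι → Fin (n + 1)) → ℝ) :
    ∫ u, g (fun i => bin n (u i)) ∂(Measure.pi fun _ : ι => unitUniform) = 𝔼 r, g r := by
  have hmeas : Measurable fun (u : ι → ℝ) i => bin n (u i) :=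
    measurable_pi_lambda _ fun i => (measurable_bin n).comp (measurable_pi_apply i)
  have hprob : IsProbabilityMeasure
      ((Measure.pi fun _ : ι => unitUniform).map fun (u : ι → ℝ) i => bin n (u i)) :=
    Measure.isProbabilityMeasure_map hmeas.aemeasurable
  rw [← integral_map (φ := fun (u : ι → ℝ) i => bin n (u i)) hmeas.aemeasurable
    (Measurable.of_discrete (f := g)).aestronglyMeasurable,
    integral_fintype Integrable.of_finite, Fintype.expect_eq_sum_div_card, Finset.sum_div]
  refine Finset.sum_congr rfl fun r _ => ?_
  have hpre : (fun (u : ι → ℝ) i => bin n (u i)) ⁻¹' {r} =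
      Set.univ.pi fun i => bin n ⁻¹' {r i} := by
    ext u
    simp [funext_iff]
  rw [Measure.real, Measure.map_apply hmeas (measurableSet_singleton r), hpre, Measure.pi_pi]
  simp only [unitUniform_bin_preimage]
  rw [Finset.prod_const, Finset.card_univ, ENNReal.toReal_pow,
    ENNReal.toReal_ofReal (by positivity), Fintype.card_fun, Fintype.card_fin, smul_eq_mul]
  push_cast
  rw [div_pow, one_pow]
  ring

/-- Distinct cards have independent insertion positions. The resulting integral is over a cube not
depending on n, as dominated convergence requires. -/
lemma expect_comp_injective {m : ℕ} {c : Fin m → Fin (n + 1)} (hc : Function.Injective c)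
    (g : (Fin m → Fin (n + 1)) → ℝ) :
    𝔼 r : Fin (n + 1) → Fin (n + 1), g (fun j => r (c j)) =
      ∫ u, g (fun j => bin n (u j)) ∂(Measure.pi fun _ : Fin m => unitUniform) := by
  rw [← integral_bin fun r : Fin (n + 1) → Fin (n + 1) => g fun j => r (c j)]
  have hind : ProbabilityTheory.iIndepFun (fun (i : Fin (n + 1)) (u : Fin (n + 1) → ℝ) => u i)
      (Measure.pi fun _ => unitUniform) :=
    ProbabilityTheory.iIndepFun_pi (X := fun _ => id) fun _ => aemeasurable_id
  have hmap := (hind.precomp hc).map_fun_eq_pi_map fun j => (measurable_pi_apply (c j)).aemeasurable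
  have heval : ∀ i : Fin (n + 1),
      (Measure.pi fun _ : Fin (n + 1) => unitUniform).map (fun u => u i) = unitUniform :=
    fun i => (measurePreserving_eval (fun _ : Fin (n + 1) => unitUniform) i).map_eq
  simp only [heval] at hmap
  rw [← hmap, integral_map
    (measurable_pi_lambda _ fun j => measurable_pi_apply (c j)).aemeasurable]
  exact (Measurable.of_discrete.comp (measurable_pi_lambda _ fun j =>
    (measurable_bin n).comp (measurable_pi_apply j))).aestronglyMeasurable

lemma integral_positionLaw {m : ℕ} (c : Fin m → Fin (n + 1)) {f : (Fin m → ℝ) → ℝ}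
    (hf : Measurable f) :
    ∫ x, f x ∂(positionLaw c : Measure (Fin m → ℝ)) =
      𝔼 r : Fin (n + 1) → Fin (n + 1), f fun j => rescale (pos r (n + 1) (c j)) := by
  have h : (positionLaw c : Measure (Fin m → ℝ)) =
      ((PMF.uniformOfFintype (Fin (n + 1) → Fin (n + 1))).map
        fun r j => rescale (pos r (n + 1) (c j))).toMeasure := by
    change ((shuffleLaw 1).map _).toMeasure = _
    rw [shuffleLaw, PMF.map_comp]
    congr 2
    funext r j
    simp only [Function.comp_apply, shuffle_one]
    rfl
  rw [h, ← PMF.toMeasure_map _ _ Measurable.of_discrete,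
    integral_map Measurable.of_discrete.aemeasurable hf.aestronglyMeasurable, PMF.integral_eq_sum,
    Fintype.expect_eq_sum_div_card, Finset.sum_div]
  refine Finset.sum_congr rfl fun r _ => ?_
  rw [PMF.uniformOfFintype_apply, ENNReal.toReal_inv, ENNReal.toReal_natCast, smul_eq_mul]
  ring

/-! ### Convergence in law. -/

lemma tendsto_inv_sqrt : Tendsto (fun n : ℕ => 24 / √((n : ℝ) + 1)) atTop (𝓝 0) :=
  tendsto_const_nhds.div_atTop (Real.tendsto_sqrt_atTop.comp
    (tendsto_atTop_add_const_right _ 1 tendsto_natCast_atTop_atTop))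

/-- 24 = 23 + 1, the extra 1 paying for the one-based index in `rescale`. -/
lemma expect_abs_rescale_sub_le (k : Fin (n + 1)) :
    𝔼 r : Fin (n + 1) → Fin (n + 1),
      |rescale (pos r (n + 1) k) - target n k (r k) / ((n : ℝ) + 1)| ≤ 24 / √((n : ℝ) + 1) := by
  have hn : (0 : ℝ) < (n : ℝ) + 1 := by positivity
  have hs1 : 1 ≤ √((n : ℝ) + 1) := Real.one_le_sqrt.2 (by linarith [Nat.cast_nonneg (α := ℝ) n])
  have hsq : √((n : ℝ) + 1) * √((n : ℝ) + 1) = n + 1 := Real.mul_self_sqrt hn.le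
  have h : ∀ r : Fin (n + 1) → Fin (n + 1),
      |rescale (pos r (n + 1) k) - target n k (r k) / ((n : ℝ) + 1)| ≤
        (|((pos r (n + 1) k : ℕ) : ℝ) - target n k (r k)| + 1) / ((n : ℝ) + 1) := by
    intro r
    rw [rescale, ← sub_div, abs_div, abs_of_pos hn, add_sub_right_comm]
    gcongr
    exact (abs_add_le _ _).trans (by rw [abs_one])
  refine (Finset.expect_le_expect fun r _ => h r).trans ?_
  rw [← Finset.expect_div, Finset.expect_add_distrib, Fintype.expect_const]
  have h1 := expect_abs_pos_sub_target_le k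
  calc _ ≤ (23 * √((n : ℝ) + 1) + √((n : ℝ) + 1)) / ((n : ℝ) + 1) := by gcongr
    _ = 24 / √((n : ℝ) + 1) := by
        nth_rewrite 3 [← hsq]
        field_simp
        ring

/-- Replacing the final positions by functions of the insertion positions is asymptotically
harmless. -/
lemma abs_expect_sub_expect_le {m : ℕ} (c : Fin m → Fin (n + 1)) {f : (Fin m → ℝ) → ℝ} {L : NNReal}
    (hL : LipschitzWith L f) :
    |(𝔼 r : Fin (n + 1) → Fin (n + 1), f fun j => rescale (pos r (n + 1) (c j))) -
      𝔼 r : Fin (n + 1) → Fin (n + 1), f fun j => target n (c j) (r (c j)) / ((n : ℝ) + 1)| ≤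
      L * (m * (24 / √((n : ℝ) + 1))) := by
  rw [← Finset.expect_sub_distrib]
  refine (Finset.abs_expect_le _ _).trans ?_
  have h : ∀ r : Fin (n + 1) → Fin (n + 1),
      |(f fun j => rescale (pos r (n + 1) (c j))) -
        f fun j => target n (c j) (r (c j)) / ((n : ℝ) + 1)| ≤
      L * ∑ j, |rescale (pos r (n + 1) (c j)) - target n (c j) (r (c j)) / ((n : ℝ) + 1)| := by
    intro r
    refine (hL.dist_le_mul _ _).trans ?_
    gcongr
    refine (dist_pi_le_iff (by positivity)).2 fun j => ?_
    exact Finset.single_le_sum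
      (f := fun j => |rescale (pos r (n + 1) (c j)) - target n (c j) (r (c j)) / ((n : ℝ) + 1)|)
      (fun _ _ => abs_nonneg _) (Finset.mem_univ j)
  refine (Finset.expect_le_expect fun r _ => h r).trans ?_
  rw [← Finset.mul_expect, Finset.expect_sum_comm]
  gcongr
  refine (Finset.sum_le_sum fun j _ => expect_abs_rescale_sub_le (c j)).trans ?_
  simp

lemma tendsto_bin_div {u : ℝ} (hu : u ∈ Set.Ico (0 : ℝ) 1) :
    Tendsto (fun n : ℕ => ((bin n u : ℕ) : ℝ) / ((n : ℝ) + 1)) atTop (𝓝 u) := by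
  have h := tendsto_floor_div (z := fun n => ((n : ℝ) + 1) * u) (l := u)
    (tendsto_const_nhds.congr fun n => by field_simp)
  rw [max_eq_left hu.1] at h
  exact h.congr fun n => by rw [val_bin hu]

lemma tendsto_val_div {c : (n : ℕ) → Fin (n + 1)} {b : ℝ}
    (hb : Tendsto (fun n => rescale (c n)) atTop (𝓝 b)) :
    Tendsto (fun n => ((c n : ℕ) : ℝ) / ((n : ℝ) + 1)) atTop (𝓝 b) := by
  have h := hb.sub (tendsto_one_div_add_atTop_nhds_zero_nat (𝕜 := ℝ))
  rw [sub_zero] at h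
  exact h.congr fun n => by rw [rescale, ← sub_div, add_sub_cancel_right]

lemma limit_mem_Icc {c : (n : ℕ) → Fin (n + 1)} {b : ℝ}
    (hb : Tendsto (fun n => rescale (c n)) atTop (𝓝 b)) : b ∈ Set.Icc (0 : ℝ) 1 := by
  refine isClosed_Icc.mem_of_tendsto hb (Eventually.of_forall fun n => ⟨?_, ?_⟩)
  · rw [rescale]; positivity
  · exact div_le_one_of_le₀ (by exact_mod_cast (c n).isLt) (by positivity)

lemma tendsto_integral_target {m : ℕ} {b : Fin m → ℝ} {c : (n : ℕ) → Fin m → Fin (n + 1)}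
    (hb : ∀ j, Tendsto (fun n => rescale (c n j)) atTop (𝓝 (b j)))
    {f : (Fin m → ℝ) → ℝ} (hf : Continuous f) {C : ℝ} (hC : ∀ x, |f x| ≤ C) :
    Tendsto (fun n : ℕ => ∫ u, f (fun j => target n (c n j) (bin n (u j)) / ((n : ℝ) + 1))
        ∂(Measure.pi fun _ : Fin m => unitUniform)) atTop
      (𝓝 (∫ u, f (fun j => quantile (b j) (u j)) ∂(Measure.pi fun _ : Fin m => unitUniform))) := by
  refine tendsto_integral_of_dominated_convergence (fun _ => C) (fun n => ?_)
    (integrable_const C) (fun n => Eventually.of_forall fun u => hC _) ?_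
  · have hmeas : ∀ k : ℕ, Measurable fun u : ℝ => target n k (bin n u) / ((n : ℝ) + 1) := fun k =>
      (Measurable.of_discrete (f := fun i : Fin (n + 1) => target n k i / ((n : ℝ) + 1))).comp
        (measurable_bin n)
    exact (hf.measurable.comp (measurable_pi_lambda _ fun j =>
      (hmeas _).comp (measurable_pi_apply j))).aestronglyMeasurable
  · have hae : ∀ᵐ u ∂(Measure.pi fun _ : Fin m => unitUniform), ∀ j, u j ∈ Set.Ico (0 : ℝ) 1 :=
      ae_all_iff.2 fun j => Measure.tendsto_eval_ae_ae.eventually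
        (ae_restrict_mem (μ := volume) measurableSet_Ico)
    filter_upwards [hae] with u hu
    refine (hf.tendsto _).comp (tendsto_pi_nhds.2 fun j => ?_)
    exact tendsto_target (fun n => Nat.lt_succ_iff.1 (c n j).isLt) (hu j).2.le
      (tendsto_val_div (hb j)) (tendsto_bin_div (hu j))

end CardCyclic

theorem corollary3 (m : ℕ) (b : Fin m → ℝ) (c : (n : ℕ) → Fin m → Fin (n + 1))
    (hc : ∀ᶠ n in atTop, StrictMono (c n))
    (hb : ∀ j, Tendsto (fun n => CardCyclic.rescale (c n j)) atTop (𝓝 (b j))) :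
    ∃ μ : ProbabilityMeasure (Fin m → ℝ),
      (μ : Measure (Fin m → ℝ)) =
        Measure.pi (fun j => volume.withDensity
          (fun x => ENNReal.ofReal (CardCyclic.density (b j) x))) ∧
      (μ : Measure (Fin m → ℝ)) =
        volume.withDensity
          (fun x => ENNReal.ofReal (∏ j, CardCyclic.density (b j) (x j))) ∧
      Tendsto (fun n => CardCyclic.positionLaw (c n)) atTop (𝓝 μ) := by
  open CardCyclic in
  have hb01 : ∀ j, b j ∈ Set.Icc (0 : ℝ) 1 := fun j => limit_mem_Icc (hb j)
  have hprob := fun j => isProbabilityMeasure_density (hb01 j)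
  let μ : ProbabilityMeasure (Fin m → ℝ) :=
    ⟨Measure.pi fun j => volume.withDensity fun x => ENNReal.ofReal (density (b j) x),
      inferInstance⟩
  refine ⟨μ, rfl, pi_withDensity_ofReal (fun j => integrable_density (hb01 j))
      (fun j => density_nonneg (hb01 j)), ?_⟩
  have hquant : Measurable fun (u : Fin m → ℝ) j => quantile (b j) (u j) :=
    measurable_pi_lambda _ fun j =>
      (continuous_quantile (b j)).measurable.comp (measurable_pi_apply j)
  have hmap : (Measure.pi fun _ : Fin m => unitUniform).map
      (fun u j => quantile (b j) (u j)) =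
      Measure.pi fun j => volume.withDensity fun x => ENNReal.ofReal (density (b j) x) := by
    have hsf : ∀ j, SigmaFinite (unitUniform.map (quantile (b j))) := fun j => by
      rw [unitUniform, map_quantile (hb01 j)]
      infer_instance
    rw [Measure.pi_map_pi fun j => (continuous_quantile (b j)).aemeasurable]
    simp only [unitUniform, map_quantile (hb01 _)]
  -- Bounded Lipschitz test functions suffice, and they turn the mean position error into an error
  -- of integrals.
  rw [tendsto_iff_forall_lipschitz_integral_tendsto]
  rintro f ⟨C, hC⟩ ⟨L, hL⟩
  have hCf : ∀ x, |f x| ≤ C + |f 0| := fun x => by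
    have := hC x 0
    rw [Real.dist_eq] at this
    linarith [abs_sub_abs_le_abs_sub (f x) (f 0)]
  have hlim := tendsto_integral_target hb hL.continuous hCf
  rw [← integral_map hquant.aemeasurable hL.continuous.aestronglyMeasurable, hmap] at hlim
  refine tendsto_of_tendsto_of_dist hlim ?_
  have hzero : Tendsto (fun n : ℕ => (L : ℝ) * (m * (24 / √((n : ℝ) + 1)))) atTop (𝓝 0) := by
    simpa using (tendsto_inv_sqrt.const_mul (m : ℝ)).const_mul (L : ℝ)
  refine squeeze_zero' (Eventually.of_forall fun n => dist_nonneg) ?_ hzero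
  filter_upwards [hc] with n hn
  rw [dist_comm, Real.dist_eq, integral_positionLaw (c n) hL.continuous.measurable,
    ← expect_comp_injective hn.injective
      fun ρ => f fun j => target n (c n j) (ρ j) / ((n : ℝ) + 1)]
  exact abs_expect_sub_expect_le (c n) hL
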